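/- Let $G$ be a totally disconnected, locally compact group and let $\alpha$ be an automorphism of $G$ (a group automorphism that is also a homeomorphism). A subgroup $H\le G$ is $\alpha$-stable if $\alpha(H)=H$. For a compact open subgroup $V\le G$ put $$V_+=\bigcap_{k\ge 0}\alpha^k(V),\quad V_-=\bigcap_{k\ge 0}\alpha^{-k}(V),\quad V_{++}=\bigcup_{k\ge 0}\alpha^k(V_+),\quad V_{--}=\bigcup_{k\ge 0}\alpha^{-k}(V_-),$$ and call $V$ $\alpha$-tidy if $V=V_+V_-$ and both $V_{++}$ and $V_{--}$ are closed in $G$. Let $\mathrm{nub}(\alpha)$ be the intersection of all $\alpha$-tidy compact open subgroups of $G$. Suppose that $N$ is a compact, $\alpha$-stable subgroup of $G$ with $\mathrm{nub}(\alpha)\le N$. Then: 1. for every open set $U\subseteq G$ with $N\subseteq U$ there is an $\alpha$-tidy subgroup $V$ with $N\le V\subseteq U$; 2. for every relatively open, $\alpha$-stable subgroup $J$ of $N$ there is an $\alpha$-tidy subgroup $W$ of $G$ such that $J=W\cap N$. -/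

import Mathlib

open scoped Pointwise

namespace TDLC

variable {G : Type*} [Group G] [TopologicalSpace G]

/-- The image `α^n(V)` of a subgroup `V`, for an integer `n` and a topological automorphism `α`. -/
def powImage (α : G ≃ₜ* G) (n : ℤ) (V : Subgroup G) : Subgroup G :=
  V.map (((α.toMulEquiv : MulAut G) ^ n : MulAut G) : G ≃* G).toMonoidHom

/-- A subgroup `H` is `α`-stable if `α(H) = H`. -/
def IsStable (α : G ≃ₜ* G) (H : Subgroup G) : Prop :=
  H.map α.toMulEquiv.toMonoidHom = H

/-- `V₊ = ⋂_{k ≥ 0} α^k(V)`. -/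
def plus (α : G ≃ₜ* G) (V : Subgroup G) : Subgroup G :=
  ⨅ k : ℕ, powImage α (k : ℤ) V

/-- `V₋ = ⋂_{k ≥ 0} α^{-k}(V)`. -/
def minus (α : G ≃ₜ* G) (V : Subgroup G) : Subgroup G :=
  ⨅ k : ℕ, powImage α (-(k : ℤ)) V

/-- `V₊₊ = ⋃_{k ≥ 0} α^k(V₊)`. -/
def plusPlus (α : G ≃ₜ* G) (V : Subgroup G) : Set G :=
  ⋃ k : ℕ, (powImage α (k : ℤ) (plus α V) : Set G)

/-- `V₋₋ = ⋃_{k ≥ 0} α^{-k}(V₋)`. -/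
def minusMinus (α : G ≃ₜ* G) (V : Subgroup G) : Set G :=
  ⋃ k : ℕ, (powImage α (-(k : ℤ)) (minus α V) : Set G)

/-- Condition TA(α), tidiness above: `V = V₊V₋`, a product of subsets of `G`. -/
def TidyAbove (α : G ≃ₜ* G) (V : Subgroup G) : Prop :=
  (V : Set G) = (plus α V : Set G) * (minus α V : Set G)

/-- Condition TB(α), tidiness below: `V₊₊` and `V₋₋` are closed. -/
def TidyBelow (α : G ≃ₜ* G) (V : Subgroup G) : Prop :=
  IsClosed (plusPlus α V) ∧ IsClosed (minusMinus α V)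

/-- A compact open subgroup is tidy for `α` if it is tidy above and tidy below. -/
structure IsTidy (α : G ≃ₜ* G) (V : Subgroup G) : Prop where
  isCompact : IsCompact (V : Set G)
  isOpen : IsOpen (V : Set G)
  tidyAbove : TidyAbove α V
  tidyBelow : TidyBelow α V

/-- The nub of `α`: the intersection of all (compact open) subgroups tidy for `α`. -/
def nub (α : G ≃ₜ* G) : Subgroup G :=
  sInf {V : Subgroup G | IsTidy α V}

end TDLC

/-! The proof trades closedness of `V₊₊` and `V₋₋` for a condition on orbits: `V` contains every
point whose orbit lies in `V` outside a bounded window of times (`ContainsHomoclinic`). A compact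
`V` with `V₊₊` closed satisfies it, by Baire category (`containsHomoclinic_of_isClosed_plusPlus`);
an open `V = V₊V₋` that satisfies it is tidy below (`TidyAbove.tidyBelow`). The condition passes to
intersections, so by compactness every open subgroup containing the nub contains an open subgroup
with this property (`exists_containsHomoclinic_le`). A compact subgroup containing such an open
subgroup is itself tidy below (`tidyBelow_of_le`).

For 1, choose a small compact open `V`, normalized by `N` and tidy above. Then `NV` is tidy above
since `N` is stable, and tidy below since it contains the nub.

For 2, take `V` so small also that `α(V)V ∩ N ⊆ J`. Then `JV ∩ N = J`. An orbit that is eventually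
in `JV` in both directions stays in the tidy group `NV`, and the smallness of `V` carries membership
in `JV` from each time to the next (`containsHomoclinic_sup`). -/

namespace TDLC

/-! ### Iterates, the groups `V₊` and `V₋`, homoclinic points and index lemmas -/

section Algebra

variable {G : Type*} [Group G] [TopologicalSpace G]

/-- The integer iterates of an automorphism, as group automorphisms. -/
def iter (α : G ≃ₜ* G) (n : ℤ) : MulAut G := (α.toMulEquiv : MulAut G) ^ n

@[simp]
theorem iter_zero (α : G ≃ₜ* G) (x : G) : iter α 0 x = x := by simp [iter]

theorem iter_one (α : G ≃ₜ* G) (x : G) : iter α 1 x = α x := by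
  rw [iter, zpow_one]
  rfl

@[simp]
theorem iter_iter (α : G ≃ₜ* G) (m n : ℤ) (x : G) : iter α m (iter α n x) = iter α (m + n) x := by
  simp [iter, zpow_add]

theorem iter_symm (α : G ≃ₜ* G) (n : ℤ) (x : G) : iter α.symm n x = iter α (-n) x := by
  have h : (α.symm.toMulEquiv : MulAut G) = (α.toMulEquiv : MulAut G)⁻¹ := rfl
  rw [iter, h, inv_zpow', iter]

theorem continuous_iter (α : G ≃ₜ* G) (n : ℤ) : Continuous (iter α n) := by
  have key : ∀ (β : G ≃ₜ* G) (k : ℕ), Continuous (iter β (k : ℤ)) := by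
    intro β k
    induction k with
    | zero => exact continuous_id.congr fun x => (iter_zero β x).symm
    | succ k ih =>
      refine ((map_continuous β).comp ih).congr fun x => ?_
      rw [Function.comp_apply, ← iter_one β (iter β k x), iter_iter]
      push_cast
      rw [add_comm]
  obtain ⟨k, rfl | rfl⟩ := n.eq_nat_or_neg
  · exact key α k
  · exact (key α.symm k).congr fun x => iter_symm α k x

theorem mem_powImage {α : G ≃ₜ* G} {n : ℤ} {V : Subgroup G} {x : G} :
    x ∈ powImage α n V ↔ iter α (-n) x ∈ V := by
  constructor
  · rintro ⟨y, hy, rfl⟩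
    change iter α (-n) (iter α n y) ∈ V
    simpa using hy
  · intro h
    refine ⟨_, h, ?_⟩
    change iter α n (iter α (-n) x) = x
    simp

theorem coe_powImage (α : G ≃ₜ* G) (n : ℤ) (V : Subgroup G) :
    (powImage α n V : Set G) = iter α (-n) ⁻¹' V := by
  ext x
  exact mem_powImage

theorem isOpen_powImage (α : G ≃ₜ* G) (n : ℤ) {V : Subgroup G} (hV : IsOpen (V : Set G)) :
    IsOpen (powImage α n V : Set G) := by
  rw [coe_powImage]
  exact hV.preimage (continuous_iter α _)

theorem isClosed_powImage (α : G ≃ₜ* G) (n : ℤ) {V : Subgroup G} (hV : IsClosed (V : Set G)) :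
    IsClosed (powImage α n V : Set G) := by
  rw [coe_powImage]
  exact hV.preimage (continuous_iter α _)

theorem isCompact_powImage (α : G ≃ₜ* G) (n : ℤ) {V : Subgroup G} (hV : IsCompact (V : Set G)) :
    IsCompact (powImage α n V : Set G) :=
  hV.image (continuous_iter α n)

theorem relIndex_powImage (α : G ≃ₜ* G) (n : ℤ) (H K : Subgroup G) :
    (powImage α n H).relIndex (powImage α n K) = H.relIndex K :=
  Subgroup.relIndex_map_map_of_injective _ _ (iter α n).injective

theorem mem_plus {α : G ≃ₜ* G} {V : Subgroup G} {x : G} :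
    x ∈ plus α V ↔ ∀ k : ℕ, iter α (-(k : ℤ)) x ∈ V := by
  simp [plus, Subgroup.mem_iInf, mem_powImage]

theorem mem_minus {α : G ≃ₜ* G} {V : Subgroup G} {x : G} :
    x ∈ minus α V ↔ ∀ k : ℕ, iter α (k : ℤ) x ∈ V := by
  simp [minus, Subgroup.mem_iInf, mem_powImage]

theorem mem_plusPlus {α : G ≃ₜ* G} {V : Subgroup G} {x : G} :
    x ∈ plusPlus α V ↔ ∃ k : ℕ, iter α (-(k : ℤ)) x ∈ plus α V := by
  simp [plusPlus, mem_powImage]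

theorem mem_minusMinus {α : G ≃ₜ* G} {V : Subgroup G} {x : G} :
    x ∈ minusMinus α V ↔ ∃ k : ℕ, iter α (k : ℤ) x ∈ minus α V := by
  simp [minusMinus, mem_powImage]

theorem plus_symm (α : G ≃ₜ* G) (V : Subgroup G) : plus α.symm V = minus α V := by
  ext x
  simp [mem_plus, mem_minus, iter_symm]

theorem minus_symm (α : G ≃ₜ* G) (V : Subgroup G) : minus α.symm V = plus α V := by
  ext x
  simp [mem_plus, mem_minus, iter_symm]

theorem plusPlus_symm (α : G ≃ₜ* G) (V : Subgroup G) : plusPlus α.symm V = minusMinus α V := by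
  ext x
  simp [mem_plusPlus, mem_minusMinus, iter_symm, plus_symm]

theorem plus_le (α : G ≃ₜ* G) (V : Subgroup G) : plus α V ≤ V := fun x hx => by
  simpa using mem_plus.1 hx 0

theorem minus_le (α : G ≃ₜ* G) (V : Subgroup G) : minus α V ≤ V := fun x hx => by
  simpa using mem_minus.1 hx 0

theorem plus_mono (α : G ≃ₜ* G) {V W : Subgroup G} (h : V ≤ W) : plus α V ≤ plus α W :=
  fun _ hx => mem_plus.2 fun k => h (mem_plus.1 hx k)

theorem minus_mono (α : G ≃ₜ* G) {V W : Subgroup G} (h : V ≤ W) : minus α V ≤ minus α W :=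
  fun _ hx => mem_minus.2 fun k => h (mem_minus.1 hx k)

theorem iter_neg_mem_plus {α : G ≃ₜ* G} {V : Subgroup G} {x : G} (hx : x ∈ plus α V) (k : ℕ) :
    iter α (-(k : ℤ)) x ∈ plus α V := by
  refine mem_plus.2 fun j => ?_
  have := mem_plus.1 hx (j + k)
  rw [iter_iter]
  convert this using 2
  push_cast
  ring_nf

theorem tidyAbove_iff {α : G ≃ₜ* G} {V : Subgroup G} :
    TidyAbove α V ↔ ∀ x ∈ V, ∃ a ∈ plus α V, a⁻¹ * x ∈ minus α V := by
  constructor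
  · intro h x hx
    have hx' : x ∈ (V : Set G) := hx
    rw [h] at hx'
    obtain ⟨a, ha, b, hb, rfl⟩ := hx'
    exact ⟨a, ha, by simpa using hb⟩
  · intro h
    refine Set.Subset.antisymm ?_ ?_
    · intro x hx
      obtain ⟨a, ha, hb⟩ := h x hx
      exact ⟨a, ha, _, hb, by simp⟩
    · rintro _ ⟨a, ha, b, hb, rfl⟩
      exact V.mul_mem (plus_le α V ha) (minus_le α V hb)

theorem TidyAbove.symm {α : G ≃ₜ* G} {V : Subgroup G} (h : TidyAbove α V) :
    TidyAbove α.symm V := by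
  rw [tidyAbove_iff] at h ⊢
  intro x hx
  obtain ⟨a, ha, hb⟩ := h x⁻¹ (V.inv_mem hx)
  refine ⟨(a⁻¹ * x⁻¹)⁻¹, ?_, ?_⟩
  · rw [plus_symm]
    exact inv_mem hb
  · rw [minus_symm]
    simpa using ha

theorem isStable_iff {α : G ≃ₜ* G} {H : Subgroup G} :
    IsStable α H ↔ ∀ (n : ℤ) (x : G), iter α n x ∈ H ↔ x ∈ H := by
  have h1 : ∀ x, x ∈ H.map α.toMulEquiv.toMonoidHom ↔ iter α (-1) x ∈ H := fun x => by
    have h := mem_powImage (α := α) (n := 1) (V := H) (x := x)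
    rwa [powImage, zpow_one] at h
  constructor
  · intro h
    have hneg : ∀ x, iter α (-1) x ∈ H ↔ x ∈ H := fun x => by
      rw [← h1, show H.map α.toMulEquiv.toMonoidHom = H from h]
    intro n
    induction n using Int.induction_on with
    | zero => simp
    | succ n ih =>
      intro x
      rw [← hneg, iter_iter, ← ih x]
      ring_nf
    | pred n ih =>
      intro x
      rw [← ih x, ← hneg (iter α (-(n : ℤ)) x), iter_iter]
      ring_nf
  · intro h
    ext x
    rw [h1]
    exact h _ x

theorem IsStable.symm {α : G ≃ₜ* G} {H : Subgroup G} (h : IsStable α H) : IsStable α.symm H := by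
  rw [isStable_iff] at h ⊢
  intro n x
  rw [iter_symm]
  exact h _ x

theorem IsStable.powImage_eq {α : G ≃ₜ* G} {H : Subgroup G} (h : IsStable α H) (n : ℤ) :
    powImage α n H = H := by
  ext x
  rw [mem_powImage]
  exact isStable_iff.1 h _ x

/-- Every point whose orbit is in `V` outside a bounded interval of times is itself in `V`. -/
def ContainsHomoclinic (α : G ≃ₜ* G) (V : Subgroup G) : Prop :=
  ∀ (x : G) (k : ℕ), (∀ n : ℤ, (k : ℤ) ≤ |n| → iter α n x ∈ V) → x ∈ V

theorem ContainsHomoclinic.symm {α : G ≃ₜ* G} {V : Subgroup G} (h : ContainsHomoclinic α V) :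
    ContainsHomoclinic α.symm V := by
  intro x k hx
  refine h x k fun n hn => ?_
  have := hx (-n) (by rwa [abs_neg])
  rwa [iter_symm, neg_neg] at this

theorem ContainsHomoclinic.iter_mem {α : G ≃ₜ* G} {V : Subgroup G} (h : ContainsHomoclinic α V)
    {x : G} {k : ℕ} (hx : ∀ n : ℤ, (k : ℤ) ≤ |n| → iter α n x ∈ V) (m : ℤ) : iter α m x ∈ V := by
  refine h _ (k + m.natAbs) fun n hn => ?_
  rw [iter_iter]
  refine hx _ ?_
  push_cast at hn
  have := abs_sub_abs_le_abs_sub n (-m)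
  rw [abs_neg, sub_neg_eq_add] at this
  omega

theorem ContainsHomoclinic.inf {α : G ≃ₜ* G} {V W : Subgroup G} (hV : ContainsHomoclinic α V)
    (hW : ContainsHomoclinic α W) : ContainsHomoclinic α (V ⊓ W) := fun x k hx =>
  ⟨hV x k fun n hn => (hx n hn).1, hW x k fun n hn => (hx n hn).2⟩

theorem ContainsHomoclinic.iInf {ι : Sort*} {α : G ≃ₜ* G} {V : ι → Subgroup G}
    (hV : ∀ i, ContainsHomoclinic α (V i)) : ContainsHomoclinic α (⨅ i, V i) := fun x k hx =>
  Subgroup.mem_iInf.2 fun i => hV i x k fun n hn => Subgroup.mem_iInf.1 (hx n hn) i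

theorem IsStable.containsHomoclinic {α : G ≃ₜ* G} {H : Subgroup G} (h : IsStable α H) :
    ContainsHomoclinic α H := fun x k hx =>
  (isStable_iff.1 h k x).1 (hx k (le_abs_self _))

/-- The largest stable subgroup of `V`: the elements with their whole orbit in `V`. -/
def stableCore (α : G ≃ₜ* G) (V : Subgroup G) : Subgroup G := plus α V ⊓ minus α V

theorem mem_stableCore {α : G ≃ₜ* G} {V : Subgroup G} {x : G} :
    x ∈ stableCore α V ↔ ∀ n : ℤ, iter α n x ∈ V := by
  rw [stableCore, Subgroup.mem_inf, mem_plus, mem_minus]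
  constructor
  · rintro ⟨h1, h2⟩ n
    obtain ⟨k, rfl | rfl⟩ := n.eq_nat_or_neg
    exacts [h2 k, h1 k]
  · exact fun h => ⟨fun k => h _, fun k => h _⟩

theorem isStable_stableCore (α : G ≃ₜ* G) (V : Subgroup G) : IsStable α (stableCore α V) := by
  refine isStable_iff.2 fun n x => ?_
  simp only [mem_stableCore, iter_iter]
  refine ⟨fun h m => ?_, fun h m => h _⟩
  simpa using h (m - n)

/-- The finite intersection `⋂_{0 ≤ i ≤ n} α^i(V)`. -/
def initial (α : G ≃ₜ* G) (n : ℕ) (V : Subgroup G) : Subgroup G :=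
  ⨅ i : Fin (n + 1), powImage α (i : ℕ) V

theorem mem_initial {α : G ≃ₜ* G} {n : ℕ} {V : Subgroup G} {x : G} :
    x ∈ initial α n V ↔ ∀ i ≤ n, iter α (-(i : ℤ)) x ∈ V := by
  simp only [initial, Subgroup.mem_iInf, mem_powImage]
  exact ⟨fun h i hi => h ⟨i, by omega⟩, fun h i => h i (by omega)⟩

theorem initial_le (α : G ≃ₜ* G) (n : ℕ) (V : Subgroup G) : initial α n V ≤ V := fun x hx => by
  simpa using mem_initial.1 hx 0 (Nat.zero_le n)

theorem initial_antitone (α : G ≃ₜ* G) (V : Subgroup G) : Antitone fun n => initial α n V :=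
  fun _ _ h _ hx => mem_initial.2 fun i hi => mem_initial.1 hx i (hi.trans h)

theorem plus_initial (α : G ≃ₜ* G) (n : ℕ) (V : Subgroup G) :
    plus α (initial α n V) = plus α V := by
  refine le_antisymm (plus_mono α (initial_le α n V)) fun x hx => mem_plus.2 fun k => ?_
  refine mem_initial.2 fun i _ => ?_
  exact mem_plus.1 (iter_neg_mem_plus hx k) i

theorem ContainsHomoclinic.initial {α : G ≃ₜ* G} {V : Subgroup G} (h : ContainsHomoclinic α V)
    (n : ℕ) : ContainsHomoclinic α (initial α n V) := by
  refine ContainsHomoclinic.iInf fun i x k hx => mem_powImage.2 ?_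
  have h' : ∀ n : ℤ, (k : ℤ) ≤ |n| → iter α n (iter α (-((i : ℕ) : ℤ)) x) ∈ V := fun n hn => by
    have := mem_powImage.1 (hx n hn)
    rw [iter_iter] at this ⊢
    rwa [add_comm]
  simpa using h.iter_mem h' 0

theorem isOpen_initial (α : G ≃ₜ* G) (n : ℕ) {V : Subgroup G} (hV : IsOpen (V : Set G)) :
    IsOpen (initial α n V : Set G) := by
  rw [initial, Subgroup.coe_iInf]
  exact isOpen_iInter_of_finite fun i => isOpen_powImage α _ hV

theorem isClosed_initial (α : G ≃ₜ* G) (n : ℕ) {V : Subgroup G} (hV : IsClosed (V : Set G)) :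
    IsClosed (initial α n V : Set G) := by
  rw [initial, Subgroup.coe_iInf]
  exact isClosed_iInter fun i => isClosed_powImage α _ hV

theorem isClosed_plus (α : G ≃ₜ* G) {V : Subgroup G} (hV : IsClosed (V : Set G)) :
    IsClosed (plus α V : Set G) := by
  rw [plus, Subgroup.coe_iInf]
  exact isClosed_iInter fun i => isClosed_powImage α _ hV

theorem isClosed_minus (α : G ≃ₜ* G) {V : Subgroup G} (hV : IsClosed (V : Set G)) :
    IsClosed (minus α V : Set G) := by
  rw [minus, Subgroup.coe_iInf]
  exact isClosed_iInter fun i => isClosed_powImage α _ hV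

/-- `V₊₊` as a subgroup. -/
def plusPlusSubgroup (α : G ≃ₜ* G) (V : Subgroup G) : Subgroup G where
  carrier := plusPlus α V
  one_mem' := mem_plusPlus.2 ⟨0, by simp [one_mem]⟩
  inv_mem' := by
    intro x hx
    obtain ⟨k, hk⟩ := mem_plusPlus.1 hx
    exact mem_plusPlus.2 ⟨k, by simpa using hk⟩
  mul_mem' := by
    intro x y hx hy
    obtain ⟨k, hk⟩ := mem_plusPlus.1 hx
    obtain ⟨l, hl⟩ := mem_plusPlus.1 hy
    refine mem_plusPlus.2 ⟨k + l, ?_⟩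
    rw [map_mul]
    refine mul_mem ?_ ?_
    · have := iter_neg_mem_plus hk l
      rw [iter_iter] at this
      convert this using 2
      push_cast
      ring_nf
    · have := iter_neg_mem_plus hl k
      rw [iter_iter] at this
      convert this using 2
      push_cast
      ring_nf

theorem mem_plusPlusSubgroup {α : G ≃ₜ* G} {V : Subgroup G} {x : G} :
    x ∈ plusPlusSubgroup α V ↔ ∃ k : ℕ, iter α (-(k : ℤ)) x ∈ plus α V :=
  mem_plusPlus

theorem plus_le_plusPlusSubgroup (α : G ≃ₜ* G) (V : Subgroup G) :
    plus α V ≤ plusPlusSubgroup α V := fun x hx => mem_plusPlusSubgroup.2 ⟨0, by simpa using hx⟩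

theorem isStable_plusPlusSubgroup (α : G ≃ₜ* G) (V : Subgroup G) :
    IsStable α (plusPlusSubgroup α V) := by
  have h : ∀ (m : ℤ) x, x ∈ plusPlusSubgroup α V → iter α m x ∈ plusPlusSubgroup α V := by
    intro m x hx
    obtain ⟨k, hk⟩ := mem_plusPlusSubgroup.1 hx
    refine mem_plusPlusSubgroup.2 ⟨k + m.natAbs, ?_⟩
    have h2 := iter_neg_mem_plus hk (m.natAbs - m).toNat
    rw [iter_iter] at h2 ⊢
    convert h2 using 2
    congr 1
    omega
  refine isStable_iff.2 fun n x => ⟨fun hx => ?_, h n x⟩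
  simpa using h (-n) _ hx

/-- The natural injection `K/(H ∩ K) → L/(H ∩ L)` between finite sets is onto once the source is at
least as large as the target. -/
theorem subset_mul_of_relIndex_le {G : Type*} [Group G] {H K L : Subgroup G} (hKL : K ≤ L)
    (h0 : H.relIndex L ≠ 0) (hle : H.relIndex L ≤ H.relIndex K) :
    (L : Set G) ⊆ (K : Set G) * (H : Set G) := by
  have : Finite (L ⧸ H.subgroupOf L) := Nat.finite_of_card_ne_zero h0
  have hbij := (Subgroup.quotientSubgroupOfEmbeddingOfLE H hKL).injective.bijective_of_nat_card_le
    hle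
  intro x hx
  obtain ⟨q, hq⟩ := hbij.2 (QuotientGroup.mk ⟨x, hx⟩)
  induction q using QuotientGroup.induction_on with
  | H a =>
    rw [Subgroup.quotientSubgroupOfEmbeddingOfLE_apply_mk, QuotientGroup.eq] at hq
    exact ⟨a, a.2, (a : G)⁻¹ * x, by simpa [Subgroup.mem_subgroupOf] using hq, by simp⟩

theorem relIndex_ne_zero_iff_subset_mul {G : Type*} [Group G] {H K : Subgroup G} :
    H.relIndex K ≠ 0 ↔ ∃ F : Set G, F.Finite ∧ (K : Set G) ⊆ F * (H : Set G) := by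
  constructor
  · intro h
    have : Finite (K ⧸ H.subgroupOf K) := Nat.finite_of_card_ne_zero h
    refine ⟨Set.range fun q : K ⧸ H.subgroupOf K => (q.out : G), Set.finite_range _, ?_⟩
    intro x hx
    refine ⟨_, ⟨QuotientGroup.mk ⟨x, hx⟩, rfl⟩, _, ?_, mul_inv_cancel_left _ _⟩
    have := QuotientGroup.eq.1
      (QuotientGroup.out_eq' (QuotientGroup.mk (s := H.subgroupOf K) ⟨x, hx⟩))
    simpa [Subgroup.mem_subgroupOf] using this
  · rintro ⟨F, hF, hK⟩
    have : Finite F := hF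
    have hx : ∀ x : K, ∃ f : F, (f : G)⁻¹ * x ∈ H := fun x => by
      obtain ⟨f, hf, h, hh, hfx⟩ := hK x.2
      refine ⟨⟨f, hf⟩, ?_⟩
      rw [← hfx]
      simpa using hh
    choose c hc using hx
    have : Finite (K ⧸ H.subgroupOf K) := by
      refine Finite.of_injective (fun q => c q.out) fun p q hpq => ?_
      rw [← QuotientGroup.out_eq' p, ← QuotientGroup.out_eq' q, QuotientGroup.eq,
        Subgroup.mem_subgroupOf]
      have h1 := hc p.out
      have h2 := hc q.out
      simp only at hpq
      rw [← hpq] at h2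
      simpa [mul_assoc] using mul_mem (inv_mem h1) h2
    exact Nat.card_pos.ne'

/-- Write `x = ab` with `a ∈ V₊`, `b ∈ V₋`. Then `b` also lies in `V₊₊`, so its orbit leaves `V` at
most during a bounded window, hence never. -/
theorem TidyAbove.mem_plus_of_mem_plusPlus {α : G ≃ₜ* G} {V : Subgroup G} (hV : TidyAbove α V)
    (hC : ContainsHomoclinic α V) {x : G} (hx : x ∈ V) (hx' : x ∈ plusPlusSubgroup α V) :
    x ∈ plus α V := by
  obtain ⟨a, ha, hb⟩ := tidyAbove_iff.1 hV x hx
  have hb' : a⁻¹ * x ∈ plusPlusSubgroup α V :=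
    mul_mem (inv_mem (plus_le_plusPlusSubgroup α V ha)) hx'
  obtain ⟨k, hk⟩ := mem_plusPlusSubgroup.1 hb'
  have hall : ∀ n : ℤ, (k : ℤ) ≤ |n| → iter α n (a⁻¹ * x) ∈ V := by
    intro n hn
    obtain ⟨m, rfl | rfl⟩ := n.eq_nat_or_neg
    · exact mem_minus.1 hb m
    · have hkm : k ≤ m := by simpa using hn
      have := mem_plus.1 hk (m - k)
      rw [iter_iter] at this
      convert this using 2
      congr 1
      omega
  have hp : a⁻¹ * x ∈ plus α V := mem_plus.2 fun j => hC.iter_mem hall _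
  simpa using mul_mem ha hp

/-- `A₊ ≤ α(A₊)` always, and both have the same finite index in the stable group `P`, so they
coincide. -/
theorem powImage_plus_le {α : G ≃ₜ* G} {A P : Subgroup G} (hP : IsStable α P)
    (hAP : plus α A ≤ P) (hfin : (plus α A).relIndex P ≠ 0) : powImage α 1 (plus α A) ≤ plus α A := by
  have hle : plus α A ≤ powImage α 1 (plus α A) := fun x hx =>
    mem_powImage.2 (iter_neg_mem_plus hx 1)
  have hle' : powImage α 1 (plus α A) ≤ P := (Subgroup.map_mono hAP).trans (hP.powImage_eq 1).le
  have h1 := relIndex_powImage α 1 (plus α A) P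
  rw [hP.powImage_eq] at h1
  have h2 := Subgroup.relIndex_mul_relIndex _ _ _ hle hle'
  rw [h1] at h2
  exact Subgroup.relIndex_eq_one.1 ((mul_eq_right₀ hfin).1 h2)

end Algebra

/-! ### Tidying above -/

section TidyingAbove

variable {G : Type*} [Group G] [TopologicalSpace G] [IsTopologicalGroup G]

theorem exists_mem_forall_inv_mul_mem {K : Set G} (hK : IsCompact K) (hKc : IsClosed K)
    {M : ℕ → Set G} (hM : Antitone M) (hMc : ∀ n, IsClosed (M n)) {x : G}
    (h : ∀ n, ∃ a ∈ K, a⁻¹ * x ∈ M n) : ∃ a ∈ K, ∀ n, a⁻¹ * x ∈ M n := by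
  have hcl : ∀ n, IsClosed (K ∩ (fun a => a⁻¹ * x) ⁻¹' M n) := fun n =>
    hKc.inter ((hMc n).preimage (by fun_prop))
  obtain ⟨a, ha⟩ := IsCompact.nonempty_iInter_of_sequence_nonempty_isCompact_isClosed
    (fun n => K ∩ (fun a => a⁻¹ * x) ⁻¹' M n)
    (fun n => Set.inter_subset_inter_right _ (Set.preimage_mono (hM n.le_succ)))
    (fun n => h n) (hK.inter_right ((hMc 0).preimage (by fun_prop))) hcl
  rw [Set.mem_iInter] at ha
  exact ⟨a, (ha 0).1, fun n => (ha n).2⟩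

/-- The one-step correction is iterated to keep the forward orbit of `a⁻¹x` in `W` for any finite
time; compactness of `W₊` then gives one `a` for all times. -/
theorem tidyAbove_of_forall_exists {α : G ≃ₜ* G} {W : Subgroup G} (hWc : IsCompact (W : Set G))
    (hWcl : IsClosed (W : Set G))
    (h : ∀ x ∈ W, ∃ a ∈ plus α W, iter α 1 (a⁻¹ * x) ∈ W) : TidyAbove α W := by
  have step : ∀ k : ℕ, ∀ x ∈ W, ∃ a ∈ plus α W, ∀ j ≤ k, iter α (j : ℤ) (a⁻¹ * x) ∈ W := by
    intro k
    induction k with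
    | zero => exact fun x hx => ⟨1, one_mem _, fun j hj => by simpa [Nat.le_zero.1 hj] using hx⟩
    | succ k ih =>
      intro x hx
      obtain ⟨a, ha, hax⟩ := ih x hx
      obtain ⟨b, hb, hbx⟩ := h _ (hax k le_rfl)
      have hb' : ∀ j ≤ k, iter α (j : ℤ) (iter α (-(k : ℤ)) b) ∈ W := fun j hj => by
        rw [iter_iter, show (j : ℤ) + -(k : ℤ) = -((k - j : ℕ) : ℤ) by omega]
        exact mem_plus.1 hb _
      -- Pulling `b` back by `α^k` leaves it in `W₊` and keeps times up to `k` undisturbed, while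
      -- time `k + 1` is corrected.
      refine ⟨a * iter α (-(k : ℤ)) b, mul_mem ha (iter_neg_mem_plus hb k), fun j hj => ?_⟩
      rw [mul_inv_rev, mul_assoc, map_mul, map_inv]
      rcases Nat.le_or_eq_of_le_succ hj with hj | rfl
      · exact mul_mem (inv_mem (hb' j hj)) (hax j hj)
      · rw [map_mul, map_inv, iter_iter] at hbx
        rw [iter_iter, show ((k + 1 : ℕ) : ℤ) = 1 + k by push_cast; ring,
          add_neg_cancel_right]
        exact hbx
  rw [tidyAbove_iff]
  intro x hx
  obtain ⟨a, ha, hax⟩ := exists_mem_forall_inv_mul_mem (K := (plus α W : Set G))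
    (M := fun k => {y | ∀ j ≤ k, iter α (j : ℤ) y ∈ W})
    (hWc.of_isClosed_subset (isClosed_plus α hWcl) (plus_le α W)) (isClosed_plus α hWcl)
    (fun _ _ hkl _ hy j hj => hy j (hj.trans hkl))
    (fun k => by
      simp only [Set.ofPred_forall]
      exact isClosed_biInter fun j _ => hWcl.preimage (continuous_iter α j))
    (x := x) (fun k => step k x hx)
  exact ⟨a, ha, mem_minus.2 fun k => hax k k le_rfl⟩

/-- Put `Vₙ = ⋂_{0 ≤ i ≤ n} α^i(V)`. The indices of `V ∩ α(Vₙ)` in `α(Vₙ)` are finite, so some `n`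
minimizes them. For `m ≥ n` minimality forces `α(Vₙ) ⊆ α(Vₘ)V`; letting `m` grow, compactness
replaces `Vₘ` by `V₊`, which is the one-step correction for `Vₙ`. -/
theorem exists_tidyAbove_initial {α : G ≃ₜ* G} {V : Subgroup G} (hVc : IsCompact (V : Set G))
    (hVcl : IsClosed (V : Set G)) (hfin : V.relIndex (powImage α 1 V) ≠ 0) :
    ∃ n, TidyAbove α (initial α n V) := by
  have hmono : ∀ m n, n ≤ m →
      powImage α 1 (initial α m V) ≤ powImage α 1 (initial α n V) := fun m n hmn =>
    Subgroup.map_mono (initial_antitone α V hmn)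
  have hne : ∀ n, V.relIndex (powImage α 1 (initial α n V)) ≠ 0 := fun n h =>
    hfin (Subgroup.relIndex_eq_zero_of_le_right (Subgroup.map_mono (initial_le α n V)) h)
  let n := Function.argmin fun n => V.relIndex (powImage α 1 (initial α n V))
  have hsub : ∀ m, n ≤ m → ∀ x ∈ initial α n V,
      ∃ b ∈ powImage α (-1) V, b⁻¹ * x⁻¹ ∈ initial α m V := by
    intro m hm x hx
    have h1 : iter α 1 x ∈ (powImage α 1 (initial α n V) : Set G) :=
      mem_powImage.2 (by simpa using hx)
    obtain ⟨c, hc, d, hd, hcd⟩ := subset_mul_of_relIndex_le (hmono m n hm) (hne n)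
      (Function.argmin_le (fun n => V.relIndex (powImage α 1 (initial α n V))) m) h1
    refine ⟨iter α (-1) d⁻¹, mem_powImage.2 (by simpa using hd), ?_⟩
    have hx' : x = iter α (-1) c * iter α (-1) d := by
      rw [← map_mul]
      simp only at hcd
      rw [hcd]
      simp
    rw [hx']
    simpa using mem_powImage.1 hc
  refine ⟨n, tidyAbove_of_forall_exists
    (hVc.of_isClosed_subset (isClosed_initial α n hVcl) (initial_le α n V))
    (isClosed_initial α n hVcl) fun x hx => ?_⟩
  obtain ⟨b, hb, hbx⟩ := exists_mem_forall_inv_mul_mem (K := (powImage α (-1) V : Set G))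
    (M := fun m => (initial α (n + m) V : Set G)) (isCompact_powImage α _ hVc)
    (isClosed_powImage α _ hVcl)
    (fun k l hkl => initial_antitone α V (Nat.add_le_add_left hkl n))
    (fun k => isClosed_initial α _ hVcl) (x := x⁻¹) (fun m => hsub (n + m) (by omega) x hx)
  have ha : x * b ∈ plus α V := by
    refine mem_plus.2 fun k => ?_
    have := inv_mem (hbx k)
    exact mem_initial.1 (by simpa using this) k (by omega)
  rw [plus_initial]
  refine ⟨x * b, ha, mem_initial.2 fun i hi => ?_⟩
  have hb1 : iter α 1 b ∈ V := by simpa using mem_powImage.1 hb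
  rw [mul_inv_rev, mul_assoc, inv_mul_cancel, mul_one, map_inv, map_inv]
  refine inv_mem ?_
  rw [iter_iter]
  -- Time `0` uses `b ∈ α⁻¹(V)`; for time `i + 1`, `b = x⁻¹(xb)` with `x ∈ Vₙ` and `xb ∈ V₊`.
  cases i with
  | zero => simpa using hb1
  | succ i =>
    have h1 := mem_initial.1 hx i (by omega)
    have h2 := mem_plus.1 ha i
    have h3 := mul_mem (inv_mem h1) h2
    rw [← map_inv, ← map_mul, inv_mul_cancel_left] at h3
    convert h3 using 2
    congr 1
    push_cast
    ring

theorem relIndex_ne_zero_of_isOpen {H K : Subgroup G} (hH : IsOpen (H : Set G))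
    (hK : IsCompact (K : Set G)) : H.relIndex K ≠ 0 := by
  have : CompactSpace K := isCompact_iff_compactSpace.1 hK
  have : Finite (K ⧸ H.subgroupOf K) :=
    Subgroup.quotient_finite_of_isOpen _ (hH.preimage continuous_subtype_val)
  exact Nat.card_pos.ne'

end TidyingAbove

/-! ### Tidiness below and homoclinic points -/

section TidyBelow

variable {G : Type*} [Group G] [TopologicalSpace G] [IsTopologicalGroup G]

/-- Inside the open subgroup `V`, `V₊₊` reduces to the closed group `V₊`, and a locally closed
subgroup is closed. -/
theorem TidyAbove.isClosed_plusPlus {α : G ≃ₜ* G} {V : Subgroup G} (hV : TidyAbove α V)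
    (hC : ContainsHomoclinic α V) (hVo : IsOpen (V : Set G)) : IsClosed (plusPlus α V) := by
  have hcl : IsClosed (plus α V : Set G) := isClosed_plus α (Subgroup.isClosed_of_isOpen V hVo)
  refine isClosed_of_closure_subset fun x hx => ?_
  change x ∈ plusPlusSubgroup α V
  have hx' : x ∈ (plusPlusSubgroup α V).topologicalClosure := hx
  have hxV : (fun y => x⁻¹ * y) ⁻¹' (V : Set G) ∈ nhds x :=
    (hVo.preimage (by fun_prop)).mem_nhds (by simp [one_mem])
  obtain ⟨p, hpV, hp⟩ := mem_closure_iff_nhds.1 hx _ hxV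
  have hp' : p ∈ plusPlusSubgroup α V := hp
  have hq : p⁻¹ * x ∈ (V : Set G) := by simpa using inv_mem (show x⁻¹ * p ∈ V from hpV)
  have hq' : p⁻¹ * x ∈ closure (plusPlus α V) :=
    mul_mem (inv_mem ((plusPlusSubgroup α V).le_topologicalClosure hp')) hx'
  have hsub : (V : Set G) ∩ plusPlus α V ⊆ plus α V := fun y hy =>
    hV.mem_plus_of_mem_plusPlus hC hy.1 hy.2
  have := closure_minimal hsub hcl (hVo.inter_closure ⟨hq, hq'⟩)
  simpa using mul_mem hp' (plus_le_plusPlusSubgroup α V this)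

theorem TidyAbove.tidyBelow {α : G ≃ₜ* G} {V : Subgroup G} (hV : TidyAbove α V)
    (hC : ContainsHomoclinic α V) (hVo : IsOpen (V : Set G)) : TidyBelow α V :=
  ⟨hV.isClosed_plusPlus hC hVo, plusPlus_symm α V ▸ hV.symm.isClosed_plusPlus hC.symm hVo⟩

/-- The compact group `V ∩ V₊₊` is an increasing union of closed subgroups. By Baire one of them is
open, so all later ones are too, and compactness makes one of them everything. -/
theorem exists_le_powImage_plus [T2Space G] {α : G ≃ₜ* G} {V : Subgroup G}
    (hVc : IsCompact (V : Set G)) (hcl : IsClosed (plusPlus α V)) :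
    ∃ k : ℕ, V ⊓ plusPlusSubgroup α V ≤ powImage α k (plus α V) := by
  set P : Subgroup G := V ⊓ plusPlusSubgroup α V with hP
  have hPc : IsCompact (P : Set G) := hVc.inter_right hcl
  have : CompactSpace P := isCompact_iff_compactSpace.1 hPc
  let H : ℕ → Subgroup P := fun k => (powImage α k (plus α V)).subgroupOf P
  have hHmono : Monotone H := by
    intro k l hkl x hx
    refine Subgroup.mem_subgroupOf.2 (mem_powImage.2 ?_)
    have := iter_neg_mem_plus (mem_powImage.1 (Subgroup.mem_subgroupOf.1 hx)) (l - k)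
    rw [iter_iter] at this
    convert this using 2
    congr 1
    omega
  have hHcl : ∀ k, IsClosed (H k : Set P) := fun k =>
    (isClosed_powImage α k (isClosed_plus α hVc.isClosed)).preimage continuous_subtype_val
  have hcov : ⋃ k, (H k : Set P) = Set.univ := by
    refine Set.eq_univ_of_forall fun x => ?_
    obtain ⟨k, hk⟩ := mem_plusPlusSubgroup.1 x.2.2
    exact Set.mem_iUnion.2 ⟨k, mem_powImage.2 hk⟩
  obtain ⟨k, y, hy⟩ := nonempty_interior_of_iUnion_of_closed hHcl hcov
  have hopen : ∀ j, IsOpen (H (k + j) : Set P) := fun j =>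
    Subgroup.isOpen_mono (hHmono (Nat.le_add_right k j))
      ((H k).isOpen_of_mem_nhds (mem_interior_iff_mem_nhds.1 hy))
  obtain ⟨j, hj⟩ := isCompact_univ.elim_directed_cover (fun j => (H (k + j) : Set P)) hopen
    (fun x _ => by
      obtain ⟨i, hi⟩ := Set.mem_iUnion.1 (hcov ▸ Set.mem_univ x)
      exact Set.mem_iUnion.2 ⟨i, hHmono (Nat.le_add_left i k) hi⟩)
    (Monotone.directed_le fun i j hij => hHmono (Nat.add_le_add_left hij k))
  exact ⟨k + j, fun x hx => Subgroup.mem_subgroupOf.1 (hj (Set.mem_univ (⟨x, hx⟩ : P)))⟩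

theorem containsHomoclinic_of_isClosed_plusPlus [T2Space G] {α : G ≃ₜ* G} {V : Subgroup G}
    (hVc : IsCompact (V : Set G)) (hcl : IsClosed (plusPlus α V)) : ContainsHomoclinic α V := by
  obtain ⟨k, hk⟩ := exists_le_powImage_plus hVc hcl
  intro x l hx
  -- The shift `k + l` is late enough to lie in `V`, and `α^{k+l}(x) ∈ α^k(V₊)` means `α^l(x) ∈ V₊`,
  -- whence `x ∈ V`.
  have hP : iter α (k + l : ℕ) x ∈ V ⊓ plusPlusSubgroup α V := by
    refine ⟨hx _ (by rw [Nat.abs_cast]; omega), mem_plusPlusSubgroup.2 ⟨k + l + l, ?_⟩⟩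
    refine mem_plus.2 fun j => ?_
    rw [iter_iter, iter_iter]
    refine hx _ ?_
    rw [le_abs]
    omega
  have := mem_plus.1 (mem_powImage.1 (hk hP)) l
  rw [iter_iter, iter_iter] at this
  rwa [show -(l : ℤ) + -(k : ℤ) + ((k + l : ℕ) : ℤ) = 0 by omega, iter_zero] at this

theorem IsTidy.containsHomoclinic [T2Space G] {α : G ≃ₜ* G} {V : Subgroup G} (hV : IsTidy α V) :
    ContainsHomoclinic α V :=
  containsHomoclinic_of_isClosed_plusPlus hV.isCompact hV.tidyBelow.1

end TidyBelow

/-! ### Comparing a compact subgroup with an open subgroup inside it -/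

section Comparison

variable {G : Type*} [Group G] [TopologicalSpace G]

/-- `B₊₊` lies in `Q` and meets `B` in `B₊`, so `B₊` has finite index in the stable group `B₊₊`.
Hence `α(B₊) ≤ B₊`, and forward orbits from `B₊` never leave `B`. -/
theorem TidyAbove.plus_le_minus {α : G ≃ₜ* G} {B Q : Subgroup G} (hB : TidyAbove α B)
    (hC : ContainsHomoclinic α B) (hQ : IsStable α Q) (hBQ : B ≤ Q) (hfin : B.relIndex Q ≠ 0) :
    plus α B ≤ minus α B := by
  have hPQ : plusPlusSubgroup α B ≤ Q := fun x hx => by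
    obtain ⟨k, hk⟩ := mem_plusPlusSubgroup.1 hx
    exact (isStable_iff.1 hQ _ x).1 (hBQ (plus_le α B hk))
  have h1 : (B ⊓ plusPlusSubgroup α B).relIndex (plusPlusSubgroup α B) ≠ 0 := by
    rw [Subgroup.inf_relIndex_right]
    exact fun h => hfin (Subgroup.relIndex_eq_zero_of_le_right hPQ h)
  have h2 : (plus α B).relIndex (plusPlusSubgroup α B) ≠ 0 := fun h =>
    h1 (Subgroup.relIndex_eq_zero_of_le_left
      (fun x hx => hB.mem_plus_of_mem_plusPlus hC hx.1 hx.2) h)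
  have h3 := powImage_plus_le (isStable_plusPlusSubgroup α B) (plus_le_plusPlusSubgroup α B) h2
  intro x hx
  have h4 : ∀ k : ℕ, iter α (k : ℤ) x ∈ plus α B := by
    intro k
    induction k with
    | zero => simpa using hx
    | succ k ih =>
      refine h3 (mem_powImage.2 ?_)
      rw [iter_iter]
      simpa using ih
  exact mem_minus.2 fun k => plus_le α B (h4 k)

theorem stableCore_mono (α : G ≃ₜ* G) {V W : Subgroup G} (h : V ≤ W) :
    stableCore α V ≤ stableCore α W :=
  inf_le_inf (plus_mono α h) (minus_mono α h)

theorem TidyAbove.le_stableCore {α : G ≃ₜ* G} {B Q : Subgroup G} (hB : TidyAbove α B)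
    (hC : ContainsHomoclinic α B) (hQ : IsStable α Q) (hBQ : B ≤ Q) (hfin : B.relIndex Q ≠ 0) :
    B ≤ stableCore α B := by
  have h1 := hB.plus_le_minus hC hQ hBQ hfin
  have h2 := hB.symm.plus_le_minus hC.symm hQ.symm hBQ hfin
  rw [plus_symm, minus_symm] at h2
  intro x hx
  obtain ⟨a, ha, hb⟩ := tidyAbove_iff.1 hB x hx
  have := mul_mem (show a ∈ stableCore α B from ⟨ha, h1 ha⟩)
    (show a⁻¹ * x ∈ stableCore α B from ⟨h2 hb, hb⟩)
  simpa using this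

theorem relIndex_initial_ne_zero {α : G ≃ₜ* G} {A Q : Subgroup G} (hQ : IsStable α Q)
    (hfin : A.relIndex Q ≠ 0) (n : ℕ) : (initial α n A).relIndex Q ≠ 0 := by
  refine Subgroup.relIndex_iInf_ne_zero fun i => ?_
  rw [← hQ.powImage_eq (i : ℕ), relIndex_powImage]
  exact hfin

theorem plusPlusSubgroup_mono (α : G ≃ₜ* G) {V W : Subgroup G} (h : V ≤ W) :
    plusPlusSubgroup α V ≤ plusPlusSubgroup α W := fun x hx => by
  obtain ⟨k, hk⟩ := mem_plusPlusSubgroup.1 hx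
  exact mem_plusPlusSubgroup.2 ⟨k, plus_mono α h hk⟩

variable [IsTopologicalGroup G] [T2Space G]

/-- Tidying `W ∩ Q` above yields a subgroup of finite index in `Q`; by `TidyAbove.le_stableCore` its
orbits stay in it, so it lies in the stable core of `W`. -/
theorem relIndex_stableCore_ne_zero {α : G ≃ₜ* G} {Q W : Subgroup G} (hQ : IsStable α Q)
    (hQc : IsCompact (Q : Set G)) (hWo : IsOpen (W : Set G)) (hW : ContainsHomoclinic α W) :
    (stableCore α W).relIndex Q ≠ 0 := by
  have hfin : (W ⊓ Q).relIndex Q ≠ 0 := by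
    rw [Subgroup.inf_relIndex_right]
    exact relIndex_ne_zero_of_isOpen hWo hQc
  have hAcl : IsClosed ((W ⊓ Q : Subgroup G) : Set G) :=
    (W.isClosed_of_isOpen hWo).inter hQc.isClosed
  have hfin' : (W ⊓ Q).relIndex (powImage α 1 (W ⊓ Q)) ≠ 0 := fun h =>
    hfin (Subgroup.relIndex_eq_zero_of_le_right
      ((Subgroup.map_mono inf_le_right).trans (hQ.powImage_eq 1).le) h)
  obtain ⟨n, hn⟩ := exists_tidyAbove_initial (hQc.of_isClosed_subset hAcl Set.inter_subset_right)
    hAcl hfin'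
  have hle := hn.le_stableCore ((hW.inf hQ.containsHomoclinic).initial n) hQ
    ((initial_le α n _).trans inf_le_right) (relIndex_initial_ne_zero hQ hfin n)
  exact fun h => relIndex_initial_ne_zero hQ hfin n (Subgroup.relIndex_eq_zero_of_le_left
    (hle.trans (stableCore_mono α ((initial_le α n _).trans inf_le_left))) h)

/-- Finitely many cosets of `W ∩ V₊` cover `V₊`. An element of `W ∩ V₊` splits along `W₋W₊`, and its
`W₋` part lies in the stable core of `V`, which finitely many cosets of the stable core of `W`
cover. -/
theorem relIndex_plusPlusSubgroup_ne_zero {α : G ≃ₜ* G} {V W : Subgroup G} (hWV : W ≤ V)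
    (hVc : IsCompact (V : Set G)) (hWo : IsOpen (W : Set G)) (hW : TidyAbove α W)
    (hC : ContainsHomoclinic α W) : (plusPlusSubgroup α W).relIndex (plus α V) ≠ 0 := by
  have hcl := isClosed_plus α hVc.isClosed
  have hQc : IsCompact (stableCore α V : Set G) :=
    hVc.of_isClosed_subset (hcl.inter (isClosed_minus α hVc.isClosed))
      (fun x hx => plus_le α V hx.1)
  have hfin : (W ⊓ plus α V).relIndex (plus α V) ≠ 0 := by
    rw [Subgroup.inf_relIndex_right]
    exact relIndex_ne_zero_of_isOpen hWo (hVc.of_isClosed_subset hcl (plus_le α V))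
  obtain ⟨F, hF, hVF⟩ := relIndex_ne_zero_iff_subset_mul.1 hfin
  obtain ⟨E, hE, hVE⟩ := relIndex_ne_zero_iff_subset_mul.1
    (relIndex_stableCore_ne_zero (isStable_stableCore α V) hQc hWo hC)
  refine relIndex_ne_zero_iff_subset_mul.2 ⟨F * E, hF.mul hE, fun x hx => ?_⟩
  obtain ⟨f, hf, y, hy, rfl⟩ := hVF hx
  -- The inverse automorphism gives the order `W₋W₊`, so that the `W₊` factor can be absorbed on the
  -- right into `W₊₊`.
  obtain ⟨a, ha, hb⟩ := tidyAbove_iff.1 hW.symm y hy.1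
  rw [plus_symm] at ha
  rw [minus_symm] at hb
  have haV : a ∈ plus α V := by
    have hyV : y ∈ plus α V := hy.2
    simpa using mul_mem hyV (inv_mem (plus_mono α hWV hb))
  obtain ⟨e, he, c, hc, hec⟩ := hVE (show a ∈ stableCore α V from ⟨haV, minus_mono α hWV ha⟩)
  refine ⟨f * e, Set.mul_mem_mul hf he, c * (a⁻¹ * y), ?_, ?_⟩
  · exact plus_le_plusPlusSubgroup α W (mul_mem (show c ∈ plus α W from hc.1) hb)
  · simp only at hec ⊢
    rw [← hec]
    group

/-- As `W₊₊` is stable, its index in `α^k(V₊)` does not depend on `k`, so `α^k(V₊) ⊆ V₊W₊₊`. Thus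
`V₊₊ = V₊W₊₊`, a compact set times a closed one. -/
theorem isClosed_plusPlus_of_le {α : G ≃ₜ* G} {V W : Subgroup G} (hWV : W ≤ V)
    (hVc : IsCompact (V : Set G)) (hWo : IsOpen (W : Set G)) (hW : TidyAbove α W)
    (hC : ContainsHomoclinic α W) : IsClosed (plusPlus α V) := by
  have hne := relIndex_plusPlusSubgroup_ne_zero hWV hVc hWo hW hC
  have hcl := isClosed_plus α hVc.isClosed
  have heq : plusPlus α V = (plus α V : Set G) * plusPlus α W := by
    refine Set.Subset.antisymm ?_ ?_
    · refine Set.iUnion_subset fun k => ?_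
      have h := relIndex_powImage α k (plusPlusSubgroup α W) (plus α V)
      rw [(isStable_plusPlusSubgroup α W).powImage_eq] at h
      exact subset_mul_of_relIndex_le
        (fun x hx => mem_powImage.2 (iter_neg_mem_plus hx k)) (h ▸ hne) h.le
    · rintro _ ⟨a, ha, b, hb, rfl⟩
      exact mul_mem (plus_le_plusPlusSubgroup α V ha) (plusPlusSubgroup_mono α hWV hb)
  rw [heq]
  exact (hW.isClosed_plusPlus hC hWo).mul_left_of_isCompact
    (hVc.of_isClosed_subset hcl (plus_le α V))

theorem tidyBelow_of_le {α : G ≃ₜ* G} {V W : Subgroup G} (hWV : W ≤ V)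
    (hVc : IsCompact (V : Set G)) (hWo : IsOpen (W : Set G)) (hC : ContainsHomoclinic α W) :
    TidyBelow α V := by
  have hWcl := W.isClosed_of_isOpen hWo
  have hWc := hVc.of_isClosed_subset hWcl hWV
  obtain ⟨n, hn⟩ := exists_tidyAbove_initial hWc hWcl
    (relIndex_ne_zero_of_isOpen hWo (isCompact_powImage α 1 hWc))
  have hle := (initial_le α n W).trans hWV
  have ho := isOpen_initial α n hWo
  exact ⟨isClosed_plusPlus_of_le hle hVc ho hn (hC.initial n),
    plusPlus_symm α V ▸ isClosed_plusPlus_of_le hle hVc ho hn.symm (hC.initial n).symm⟩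

/-- For a tidy `T`, the compact set `T \ V` misses the nub, so finitely many tidy subgroups already
cut `T` down into `V`. -/
theorem exists_containsHomoclinic_le {α : G ≃ₜ* G} {V : Subgroup G} (hVo : IsOpen (V : Set G))
    (hV : nub α ≤ V) :
    ∃ W ≤ V, IsOpen (W : Set G) ∧ ContainsHomoclinic α W := by
  by_cases hne : ∃ T : Subgroup G, IsTidy α T
  · obtain ⟨T, hT⟩ := hne
    obtain ⟨u, hu⟩ := (hT.isCompact.diff hVo).elim_finite_subfamily_closed
      (fun S : {S : Subgroup G // IsTidy α S} => ((S : Subgroup G) : Set G))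
      (fun S => S.2.isCompact.isClosed) (by
        rw [Set.eq_empty_iff_forall_notMem]
        rintro x ⟨hx, hx'⟩
        refine hx.2 (hV (Subgroup.mem_sInf.2 fun S hS => ?_))
        exact Set.mem_iInter.1 hx' ⟨S, hS⟩)
    refine ⟨T ⊓ ⨅ S : u, (S : {S : Subgroup G // IsTidy α S}).1, ?_, ?_, ?_⟩
    · intro x hx
      by_contra hxV
      refine Set.eq_empty_iff_forall_notMem.1 hu x ⟨⟨hx.1, hxV⟩, ?_⟩
      exact Set.mem_iInter₂.2 fun S hS => Subgroup.mem_iInf.1 hx.2 ⟨S, hS⟩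
    · rw [Subgroup.coe_inf, Subgroup.coe_iInf]
      exact hT.isOpen.inter (isOpen_iInter_of_finite fun S => S.1.2.isOpen)
    · exact hT.containsHomoclinic.inf (.iInf fun S => S.1.2.containsHomoclinic)
  -- Without tidy subgroups the nub is an empty intersection, so `V` is all of `G`.
  · refine ⟨V, le_rfl, hVo, fun x _ _ => hV (Subgroup.mem_sInf.2 fun S hS => ?_)⟩
    exact absurd ⟨S, hS⟩ hne

end Comparison

/-! ### Small compact open subgroups -/

section OpenSubgroups

variable {G : Type*} [Group G] [TopologicalSpace G] [IsTopologicalGroup G]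

/-- The right translations preserving `K` form a subgroup, which is open by the tube lemma. -/
theorem exists_isOpen_subgroup_le {K : Set G} (hK : IsCompact K) (hKo : IsOpen K)
    (h1 : (1 : G) ∈ K) : ∃ V : Subgroup G, IsOpen (V : Set G) ∧ (V : Set G) ⊆ K := by
  obtain ⟨u, v, -, hv, hu, h1v, huv⟩ := generalized_tube_lemma hK (isCompact_singleton (x := (1 : G)))
    (hKo.preimage continuous_mul) (by rintro ⟨a, b⟩ ⟨ha, rfl⟩; simpa using ha)
  let S : Subgroup G :=
    { carrier := {g | ∀ k ∈ K, k * g ∈ K ∧ k * g⁻¹ ∈ K}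
      one_mem' := fun k hk => by simpa using hk
      mul_mem' := fun {a b} ha hb k hk => by
        refine ⟨?_, ?_⟩
        · rw [← mul_assoc]
          exact (hb _ (ha k hk).1).1
        · rw [mul_inv_rev, ← mul_assoc]
          exact (ha _ (hb k hk).2).2
      inv_mem' := fun {a} ha k hk => by
        rw [inv_inv]
        exact (ha k hk).symm }
  have hvS : v ∩ v⁻¹ ⊆ (S : Set G) := fun g hg k hk =>
    ⟨huv (Set.mk_mem_prod (hu hk) hg.1), huv (Set.mk_mem_prod (hu hk) hg.2)⟩
  refine ⟨S, S.isOpen_of_mem_nhds (g := 1) (Filter.mem_of_superset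
    ((hv.inter hv.inv).mem_nhds ⟨h1v rfl, by simpa using h1v rfl⟩) hvS), fun g hg => ?_⟩
  simpa using (hg 1 h1).1

theorem exists_isCompact_isOpen_subgroup [LocallyCompactSpace G] [TotallyDisconnectedSpace G]
    {O : Set G} (hO : O ∈ nhds 1) :
    ∃ V : Subgroup G, IsCompact (V : Set G) ∧ IsOpen (V : Set G) ∧ (V : Set G) ⊆ O := by
  obtain ⟨C, hC, hCO, hCc⟩ := local_compact_nhds hO
  obtain ⟨K, hK, h1K, hKC⟩ := loc_compact_Haus_tot_disc_of_zero_dim.mem_nhds_iff.1 hC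
  have hKc := hCc.of_isClosed_subset hK.isClosed hKC
  obtain ⟨V, hV, hVK⟩ := exists_isOpen_subgroup_le hKc hK.isOpen h1K
  exact ⟨V, hKc.of_isClosed_subset (V.isClosed_of_isOpen hV) hVK, hV, hVK.trans (hKC.trans hCO)⟩

/-- The intersection of the `N`-conjugates of a small `V` remains open because `N` is compact. -/
theorem exists_normalized_isCompact_isOpen_subgroup [LocallyCompactSpace G]
    [TotallyDisconnectedSpace G] {N : Subgroup G} (hN : IsCompact (N : Set G)) {O : Set G}
    (hO : O ∈ nhds 1) : ∃ V : Subgroup G, IsCompact (V : Set G) ∧ IsOpen (V : Set G) ∧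
      (V : Set G) ⊆ O ∧ ∀ n ∈ N, ∀ v ∈ V, n * v * n⁻¹ ∈ V := by
  obtain ⟨V, hVc, hVo, hVO⟩ := exists_isCompact_isOpen_subgroup hO
  let S : Subgroup G := ⨅ n : N, V.comap (MulAut.conj (n : G)).toMonoidHom
  have hS : ∀ x, x ∈ S ↔ ∀ n ∈ N, n * x * n⁻¹ ∈ V := fun x => by
    simp [S, Subgroup.mem_iInf]
  obtain ⟨u, v, -, hv, hu, h1v, huv⟩ := generalized_tube_lemma hN
    (isCompact_singleton (x := (1 : G)))
    (hVo.preimage (f := fun p : G × G => p.1 * p.2 * p.1⁻¹) (by fun_prop))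
    (by rintro ⟨a, b⟩ ⟨ha, rfl⟩; simp [one_mem])
  have hSo : IsOpen (S : Set G) := S.isOpen_of_mem_nhds (g := 1)
    (Filter.mem_of_superset (hv.mem_nhds (h1v rfl)) fun x hx =>
      (hS x).2 fun n hn => huv (Set.mk_mem_prod (hu hn) hx))
  have hSV : S ≤ V := fun x hx => by simpa using (hS x).1 hx 1 (one_mem _)
  refine ⟨S, hVc.of_isClosed_subset (S.isClosed_of_isOpen hSo) hSV, hSo,
    fun x hx => hVO (hSV hx), fun n hn x hx => (hS _).2 fun m hm => ?_⟩
  simpa [mul_assoc] using (hS x).1 hx (m * n) (mul_mem hm hn)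

end OpenSubgroups

/-! ### Products of a stable subgroup with a subgroup it normalizes -/

section Extension

variable {G : Type*} [Group G] [TopologicalSpace G]

theorem le_normalizer_initial {α : G ≃ₜ* G} {N V : Subgroup G} (hN : IsStable α N)
    (hNV : ∀ g ∈ N, ∀ v ∈ V, g * v * g⁻¹ ∈ V) (n : ℕ) :
    N ≤ Subgroup.normalizer (initial α n V : Set G) := by
  have h : ∀ g ∈ N, ∀ v ∈ initial α n V, g * v * g⁻¹ ∈ initial α n V := fun g hg v hv =>
    mem_initial.2 fun i hi => by
      rw [map_mul, map_mul, map_inv]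
      exact hNV _ ((isStable_iff.1 hN _ g).2 hg) _ (mem_initial.1 hv i hi)
  intro g hg
  refine Subgroup.mem_normalizer_iff.2 fun v => ⟨h g hg v, fun hv => ?_⟩
  simpa [mul_assoc] using h g⁻¹ (inv_mem hg) _ hv

theorem TidyAbove.sup {α : G ≃ₜ* G} {J V : Subgroup G} (hV : TidyAbove α V) (hJ : IsStable α J)
    (hJV : J ≤ Subgroup.normalizer (V : Set G)) : TidyAbove α (J ⊔ V) := by
  rw [tidyAbove_iff]
  intro x hx
  have hx' : x ∈ ((J ⊔ V : Subgroup G) : Set G) := hx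
  rw [Subgroup.coe_mul_of_left_le_normalizer_right J V hJV] at hx'
  obtain ⟨j, hj, v, hv, rfl⟩ := hx'
  obtain ⟨a, ha, hb⟩ := tidyAbove_iff.1 hV v hv
  refine ⟨j * a, mul_mem (mem_plus.2 fun k => ?_) (plus_mono α le_sup_right ha), ?_⟩
  · exact le_sup_left (a := J) ((isStable_iff.1 hJ _ j).2 hj)
  · simpa [mul_assoc] using minus_mono α (le_sup_right (a := J)) hb

/-- The orbit stays in `NV`. If it is at `av ∈ JV` and next at `bw ∈ NV`, then `α(a)⁻¹b = α(v)w⁻¹`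
lies in `N ∩ α(V)V`, hence in `J`; so `b ∈ J`. -/
theorem containsHomoclinic_sup {α : G ≃ₜ* G} {N J V : Subgroup G} (hJ : IsStable α J)
    (hJN : J ≤ N) (hNV : N ≤ Subgroup.normalizer (V : Set G))
    (hVJ : ∀ v ∈ V, ∀ w ∈ V, iter α 1 v * w ∈ N → iter α 1 v * w ∈ J)
    (hC : ContainsHomoclinic α (N ⊔ V)) : ContainsHomoclinic α (J ⊔ V) := by
  intro x k hx
  have hNx : ∀ n, iter α n x ∈ (N : Set G) * V := fun n => by
    rw [← Subgroup.coe_mul_of_left_le_normalizer_right N V hNV]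
    exact hC.iter_mem (fun m hm => sup_le_sup_right hJN V (hx m hm)) n
  have step : ∀ n, iter α n x ∈ J ⊔ V → iter α (1 + n) x ∈ J ⊔ V := by
    intro n hn
    have hn' : iter α n x ∈ ((J ⊔ V : Subgroup G) : Set G) := hn
    rw [Subgroup.coe_mul_of_left_le_normalizer_right J V (hJN.trans hNV)] at hn'
    obtain ⟨a, ha, v, hv, hav⟩ := hn'
    obtain ⟨b, hb, w, hw, hbw⟩ := hNx (1 + n)
    simp only at hav hbw
    have ha' : iter α 1 a ∈ J := (isStable_iff.1 hJ _ a).2 ha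
    have heq : (iter α 1 a)⁻¹ * b = iter α 1 v * w⁻¹ := by
      rw [inv_mul_eq_iff_eq_mul, ← mul_assoc, ← map_mul, hav, iter_iter, ← hbw,
        mul_inv_cancel_right]
    have hmem : iter α 1 v * w⁻¹ ∈ J := by
      refine hVJ v hv _ (inv_mem hw) ?_
      rw [← heq]
      exact mul_mem (inv_mem (hJN ha')) hb
    rw [← heq] at hmem
    have hbJ : b ∈ J := by simpa using mul_mem ha' hmem
    rw [← hbw]
    exact mul_mem (le_sup_left (a := J) hbJ) (le_sup_right (a := J) hw)
  -- The induction starts at time `-k`, where membership is given, and runs forward to time `0`.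
  have hall : ∀ m : ℕ, iter α (m + -(k : ℤ)) x ∈ J ⊔ V := by
    intro m
    induction m with
    | zero => exact hx _ (by simp)
    | succ m ih =>
      convert step _ ih using 2
      congr 1
      push_cast
      ring
  simpa using hall k

end Extension

end TDLC

/-! ### The theorem -/

theorem proposition4p4 {G : Type*} [Group G] [TopologicalSpace G] [IsTopologicalGroup G]
    [LocallyCompactSpace G] [TotallyDisconnectedSpace G]
    (α : G ≃ₜ* G) (N : Subgroup G) (hNc : IsCompact (N : Set G))
    (hNs : TDLC.IsStable α N) (hN : TDLC.nub α ≤ N) :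
    (∀ U : Set G, IsOpen U → (N : Set G) ⊆ U →
      ∃ V : Subgroup G, TDLC.IsTidy α V ∧ N ≤ V ∧ (V : Set G) ⊆ U) ∧
    (∀ J : Subgroup G, J ≤ N → IsOpen ((J.subgroupOf N : Subgroup N) : Set N) →
      TDLC.IsStable α J →
      ∃ W : Subgroup G, TDLC.IsTidy α W ∧ J = W ⊓ N) := by
  open TDLC in
  have exists_tidyAbove : ∀ O ∈ nhds (1 : G), ∃ V : Subgroup G, IsCompact (V : Set G) ∧
      IsOpen (V : Set G) ∧ (V : Set G) ⊆ O ∧ TidyAbove α V ∧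
      N ≤ Subgroup.normalizer (V : Set G) := by
    intro O hO
    obtain ⟨V, hVc, hVo, hVO, hNV⟩ := exists_normalized_isCompact_isOpen_subgroup hNc hO
    obtain ⟨n, hn⟩ := exists_tidyAbove_initial hVc hVc.isClosed
      (relIndex_ne_zero_of_isOpen hVo (isCompact_powImage α 1 hVc))
    exact ⟨initial α n V, hVc.of_isClosed_subset (isClosed_initial α n hVc.isClosed)
      (initial_le α n V), isOpen_initial α n hVo, fun x hx => hVO (initial_le α n V hx), hn,
      le_normalizer_initial hNs hNV n⟩
  have tidy_sup : ∀ V : Subgroup G, IsCompact (V : Set G) → IsOpen (V : Set G) →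
      TDLC.TidyAbove α V → N ≤ Subgroup.normalizer (V : Set G) → TDLC.IsTidy α (N ⊔ V) := by
    intro V hVc hVo hV hNV
    have hc : IsCompact ((N ⊔ V : Subgroup G) : Set G) := by
      rw [Subgroup.coe_mul_of_left_le_normalizer_right N V hNV]
      exact hNc.mul hVc
    have ho : IsOpen ((N ⊔ V : Subgroup G) : Set G) := Subgroup.isOpen_mono le_sup_right hVo
    obtain ⟨W, hW, hWo, hC⟩ := TDLC.exists_containsHomoclinic_le ho (hN.trans le_sup_left)
    exact ⟨hc, ho, hV.sup hNs hNV, TDLC.tidyBelow_of_le hW hc hWo hC⟩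
  refine ⟨fun U hU hNU => ?_, fun J hJN hJo hJ => ?_⟩
  · obtain ⟨u, v, -, hv, hu, h1v, huv⟩ := generalized_tube_lemma hNc
      (isCompact_singleton (x := (1 : G))) (hU.preimage continuous_mul)
      (by rintro ⟨a, b⟩ ⟨ha, rfl⟩; simpa using hNU ha)
    obtain ⟨V, hVc, hVo, hVv, hV, hNV⟩ := exists_tidyAbove v (hv.mem_nhds (h1v rfl))
    refine ⟨N ⊔ V, tidy_sup V hVc hVo hV hNV, le_sup_left, ?_⟩
    rw [Subgroup.coe_mul_of_left_le_normalizer_right N V hNV]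
    rintro _ ⟨a, ha, b, hb, rfl⟩
    exact huv (Set.mk_mem_prod (hu ha) (hVv hb))
  · obtain ⟨O, hO, hOJ⟩ := isOpen_induced_iff.1 hJo
    have hOJ' : ∀ x ∈ N, x ∈ O ↔ x ∈ J := fun x hx =>
      Set.ext_iff.1 hOJ ⟨x, hx⟩
    have hcont : Continuous fun p : G × G => TDLC.iter α 1 p.1 * p.2 :=
      ((TDLC.continuous_iter α 1).comp continuous_fst).mul continuous_snd
    -- Any `V ⊆ u ∩ v` satisfies `α(V)V ⊆ O`, and `O ∩ N = J`.
    obtain ⟨u, v, hu, h1u, hv, h1v, huv⟩ := mem_nhds_prod_iff'.1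
      ((hO.preimage hcont).mem_nhds (x := ((1 : G), (1 : G)))
        (by simpa using (hOJ' 1 (one_mem _)).2 (one_mem _)))
    obtain ⟨V, hVc, hVo, hVv, hV, hNV⟩ := exists_tidyAbove (u ∩ v)
      ((hu.inter hv).mem_nhds ⟨h1u, h1v⟩)
    have hVJ : ∀ v ∈ V, ∀ w ∈ V, TDLC.iter α 1 v * w ∈ N → TDLC.iter α 1 v * w ∈ J :=
      fun v hv w hw hvw => (hOJ' _ hvw).1 (huv (Set.mk_mem_prod (hVv hv).1 (hVv hw).2))
    have hJc : IsCompact (J : Set G) := by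
      have : CompactSpace N := isCompact_iff_compactSpace.1 hNc
      have h := ((J.subgroupOf N).isClosed_of_isOpen hJo).isCompact.image continuous_subtype_val
      convert h
      ext x
      simpa [Subgroup.mem_subgroupOf] using fun hx => hJN hx
    have hJV := hJN.trans hNV
    have hcoe := Subgroup.coe_mul_of_left_le_normalizer_right J V hJV
    have ho : IsOpen ((J ⊔ V : Subgroup G) : Set G) := Subgroup.isOpen_mono le_sup_right hVo
    have hTA := hV.sup hJ hJV
    refine ⟨J ⊔ V, ⟨hcoe ▸ hJc.mul hVc, ho, hTA, hTA.tidyBelow ?_ ho⟩, ?_⟩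
    · exact TDLC.containsHomoclinic_sup hJ hJN hNV hVJ
        (tidy_sup V hVc hVo hV hNV).containsHomoclinic
    · refine le_antisymm (le_inf le_sup_left hJN) ?_
      rintro x ⟨hx, hxN⟩
      obtain ⟨j, hj, w, hw, rfl⟩ := hcoe ▸ (show x ∈ ((J ⊔ V : Subgroup G) : Set G) from hx)
      have hwN : w ∈ N := by simpa using mul_mem (inv_mem (hJN hj)) hxN
      -- Taking `1` as the first factor in `hVJ` gives `V ∩ N ⊆ J`.
      exact mul_mem hj (by simpa using hVJ 1 (one_mem _) w hw (by simpa using hwN))
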